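/- Let $S$ and $A$ be countable sets (with discrete $\sigma$-algebras); for a countable set $Y$ let $P(Y)$ be the set of probability measures on $Y$. Let $\Theta_F=P(S)^{S\times A}$ be the set of stochastic dynamics, $\Theta_\Pi=P(A)^S$ the set of stochastic policies and $\Theta=\Theta_F\times\Theta_\Pi$, with the product $\sigma$-algebra (generated by the evaluations $F(s'\mid s,a)$ and $\pi(a\mid s)$). Each $\theta=(F,\pi)\in\Theta$ gives a Markov chain on $S\times A$ with transition probabilities $(s,a)\mapsto(s',a')$ equal to $F(s'\mid s,a)\,\pi(a'\mid s')$. Call $\theta$ *recurrent* if, from every initial state–action pair, the chain almost surely visits every state–action pair infinitely often. Let $p$ be a probability measure on $\Theta$ that is concentrated on recurrent $\theta$. Let $\lambda$ be a Markov kernel from $\Theta$ to $S\times A$ giving the law $\lambda(\theta)$ of the initial pair $(s_0,a_0)$ (for example a fixed law, or $s_0\sim\rho(\cdot\mid\theta)$, $a_0\sim\pi(\cdot\mid s_0)$). Let $\phi_\lambda(\theta)$ be the law on $(S\times A)^{\mathbb N}$ of the chain of $\theta$ with initial law $\lambda(\theta)$, and let $\Phi_\lambda(p)=\int_\Theta \phi_\lambda(\theta)\,p(d\theta)$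 be the law of the infinite state–action sequence obtained by rolling out $p$. **(1) Identifiability.** $p$ is determined by $\Phi_\lambda(p)$: if $p,p'$ are probability measures on $\Theta$ concentrated on recurrent $\theta$, $\lambda,\lambda'$ are Markov kernels from $\Theta$ to $S\times A$, and $\Phi_\lambda(p)=\Phi_{\lambda'}(p')$, then $p=p'$. **(2) Corollary.** The interventional policy is determined by the law of the demonstrations alone: there is a map $G$, not depending on $p$ or $\lambda$, which sends $\Phi_\lambda(p)$, for every such $p$ and $\lambda$, to the interventional policy of $p$, that is, to the family of measures on $A$, indexed by the finite histories $(s_0,a_0,\dots,s_{t-1},a_{t-1},s_t)$, $$p\bigl(\cdot\mid s_0,\mathrm{do}(a_0),\dots,s_t\bigr)=\frac{\int_\Theta \pi(\cdot\mid s_t)\prod_{i<t}F(s_{i+1}\mid s_i,a_i)\,p(dF,d\pi)}{\int_\Theta \prod_{i<t}F(s_{i+1}\mid s_i,a_i)\,p(dF,d\pi)},$$ set equal to $0$ for histories at which the denominator vanishes. -/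

import Mathlib

open MeasureTheory ProbabilityTheory Filter
open scoped ENNReal

noncomputable section

namespace CountableMDP

/-- Stochastic dynamics: to a state-action pair, a probability distribution of the next state.
As a measurable space this carries the product σ-algebra. -/
abbrev Dynamics (S A : Type*) [MeasurableSpace S] : Type _ := S × A → ProbabilityMeasure S

/-- Stochastic policies: to a state, a probability distribution on actions. -/
abbrev Policy (S A : Type*) [MeasurableSpace A] : Type _ := S → ProbabilityMeasure A

/-- Pairs `(dynamics, policy)`. -/
abbrev Param (S A : Type*) [MeasurableSpace S] [MeasurableSpace A] : Type _ :=
  Dynamics S A × Policy S A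

section Chain

variable {X : Type*} [MeasurableSpace X]

/-- The law on `X^ℕ` of the homogeneous Markov chain with initial distribution `μ` and
transition kernel `K` (constructed by the Ionescu-Tulcea theorem). -/
def chainLaw (μ : Measure X) (K : Kernel X X) [IsMarkovKernel K] : Measure (ℕ → X) :=
  Kernel.trajMeasure (X := fun _ => X) μ
    (fun n => K.comap (fun h : (i : Finset.Iic n) → X => h ⟨n, Finset.mem_Iic.2 le_rfl⟩)
      (measurable_pi_apply _))

instance (μ : Measure X) [IsProbabilityMeasure μ] (K : Kernel X X) [IsMarkovKernel K] :
    IsProbabilityMeasure (chainLaw μ K) := by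
  unfold chainLaw; infer_instance

theorem chainLaw_cylinder [Countable X] [DiscreteMeasurableSpace X]
    (μ : Measure X) [IsProbabilityMeasure μ] (K : Kernel X X) [IsMarkovKernel K]
    (n : ℕ) (x : ℕ → X) :
    chainLaw μ K {τ | ∀ i ≤ n, τ i = x i} =
      μ {x 0} * ∏ i ∈ Finset.range n, K (x i) {x (i + 1)} := by
  induction n with
  | zero =>
    have hs : {τ : ℕ → X | ∀ i ≤ 0, τ i = x i} =
        Preorder.frestrictLe (π := fun _ => X) 0 ⁻¹' {Preorder.frestrictLe 0 x} := by
      ext τ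
      simp only [Set.mem_ofPred_eq, Set.mem_preimage, Set.mem_singleton_iff, funext_iff]
      constructor
      · rintro h ⟨i, hi⟩
        exact h i (Finset.mem_Iic.1 hi)
      · intro h i hi
        exact h ⟨i, Finset.mem_Iic.2 hi⟩
    rw [hs, ← Measure.map_apply (by fun_prop) (measurableSet_singleton _), chainLaw,
      Kernel.trajMeasure, Measure.map_comp _ _ (by fun_prop), Kernel.traj_map_frestrictLe,
      Kernel.partialTraj_self, Measure.id_comp,
      Measure.map_apply (by fun_prop) (measurableSet_singleton _)]
    simp only [Finset.range_zero, Finset.prod_empty, mul_one]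
    congr 1
    ext y
    simp only [Set.mem_preimage, Set.mem_singleton_iff]
    constructor
    · intro h
      exact congrFun h ⟨0, by simp⟩
    · rintro rfl
      funext ⟨i, hi⟩
      obtain rfl : i = 0 := by simpa using hi
      rfl
  | succ n ih =>
    have hs : {τ : ℕ → X | ∀ i ≤ n, τ i = x i} =
        Preorder.frestrictLe (π := fun _ => X) n ⁻¹' {Preorder.frestrictLe n x} := by
      ext τ
      simp only [Set.mem_ofPred_eq, Set.mem_preimage, Set.mem_singleton_iff, funext_iff]
      constructor
      · rintro h ⟨i, hi⟩
        exact h i (Finset.mem_Iic.1 hi)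
      · intro h i hi
        exact h ⟨i, Finset.mem_Iic.2 hi⟩
    have hs' : {τ : ℕ → X | ∀ i ≤ n + 1, τ i = x i} =
        (fun τ : ℕ → X => (Preorder.frestrictLe (π := fun _ => X) n τ, τ (n + 1))) ⁻¹'
          ({Preorder.frestrictLe n x} ×ˢ {x (n + 1)}) := by
      ext τ
      have h1 := Set.ext_iff.1 hs τ
      simp only [Set.mem_ofPred_eq, Set.mem_preimage, Set.mem_prod, Set.mem_singleton_iff]
        at h1 ⊢
      rw [← h1]
      constructor
      · intro h
        exact ⟨fun i hi => h i (by omega), h _ le_rfl⟩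
      · rintro ⟨h, h'⟩ i hi
        rcases Nat.lt_or_ge n i with hni | hni
        · obtain rfl : i = n + 1 := by omega
          exact h'
        · exact h i hni
    have hm := measurableSet_singleton (Preorder.frestrictLe (π := fun _ : ℕ => X) n x)
    rw [hs, ← Measure.map_apply (by fun_prop) hm] at ih
    rw [hs', ← Measure.map_apply (by fun_prop) (hm.prod (measurableSet_singleton _)), chainLaw,
      ← Kernel.map_frestrictLe_trajMeasure_compProd_eq_map_trajMeasure,
      Measure.compProd_apply_prod hm (measurableSet_singleton _), lintegral_singleton,
      Finset.prod_range_succ, ← mul_assoc, ← ih, mul_comm]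
    rfl

end Chain

section MDP

variable {S A : Type*} [MeasurableSpace S] [MeasurableSpace A]
  [Countable S] [Countable A] [DiscreteMeasurableSpace S] [DiscreteMeasurableSpace A]

/-- The transition kernel on `S × A` of the chain given by `θ = (F, π)`: from `(s, a)`, draw
`s' ∼ F (s, a)` and then `a' ∼ π s'`. -/
def stepKernel (θ : Param S A) : Kernel (S × A) (S × A) where
  toFun x := (θ.1 x : Measure S).bind
    fun s' => (θ.2 s' : Measure A).map fun a' => (s', a')
  measurable' := measurable_of_countable _

theorem stepKernel_singleton (θ : Param S A) (x : S × A) (s' : S) (a' : A) :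
    stepKernel θ x {(s', a')} = (θ.1 x : Measure S) {s'} * (θ.2 s' : Measure A) {a'} := by
  change ((θ.1 x : Measure S).bind
    fun s' => (θ.2 s' : Measure A).map fun a' => (s', a')) {(s', a')} = _
  rw [Measure.bind_apply (measurableSet_singleton _) (measurable_of_countable _).aemeasurable]
  have h : ∀ u : S, ((θ.2 u : Measure A).map fun a' => (u, a')) {(s', a')} =
      ({s'} : Set S).indicator (fun _ => (θ.2 s' : Measure A) {a'}) u := by
    intro u
    rw [Measure.map_apply (measurable_of_countable _) (measurableSet_singleton _)]
    by_cases hu : u = s'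
    · subst hu
      simp only [Set.mem_singleton_iff, Set.indicator_of_mem]
      congr 1
      ext b
      simp
    · have : (fun b : A => (u, b)) ⁻¹' {(s', a')} = ∅ := by
        ext b
        simp [hu]
      simp [this, hu]
  simp_rw [h]
  rw [lintegral_indicator_const (measurableSet_singleton _), mul_comm]

instance (θ : Param S A) : IsMarkovKernel (stepKernel θ) where
  isProbabilityMeasure x := by
    constructor
    change ((θ.1 x : Measure S).bind
      fun s' => (θ.2 s' : Measure A).map fun a' => (s', a')) Set.univ = _
    rw [Measure.bind_apply MeasurableSet.univ (measurable_of_countable _).aemeasurable]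
    have h : ∀ u : S, ((θ.2 u : Measure A).map fun a' => (u, a')) Set.univ = 1 := by
      intro u
      rw [Measure.map_apply (measurable_of_countable _) MeasurableSet.univ]
      simp
    simp [h]

/-- Recurrence: almost surely, whatever the state-action pair the chain starts from, the
trajectory contains every state-action pair infinitely often. -/
def Recurrent (θ : Param S A) : Prop :=
  ∀ x y : S × A,
    ∀ᵐ τ ∂(chainLaw (Measure.dirac x) (stepKernel θ)), ∃ᶠ n in atTop, τ n = y

theorem measurable_chainLaw (init : Kernel (Param S A) (S × A)) [IsMarkovKernel init] :
    Measurable fun θ : Param S A => chainLaw (init θ) (stepKernel θ) := by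
  have hstep : ∀ x y : S × A, Measurable fun θ : Param S A => stepKernel θ x {y} := by
    rintro x ⟨s', a'⟩
    simp_rw [stepKernel_singleton]
    have h1 : Measurable fun θ : Param S A => (θ.1 x : Measure S) {s'} :=
      (Measure.measurable_coe (measurableSet_singleton s')).comp
        (measurable_subtype_coe.comp ((measurable_pi_apply x).comp measurable_fst))
    have h2 : Measurable fun θ : Param S A => (θ.2 s' : Measure A) {a'} :=
      (Measure.measurable_coe (measurableSet_singleton a')).comp
        (measurable_subtype_coe.comp ((measurable_pi_apply s').comp measurable_snd))
    exact h1.mul h2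
  have hcyl : ∀ (n : ℕ) (x : ℕ → S × A), Measurable fun θ : Param S A =>
      chainLaw (init θ) (stepKernel θ) {τ | ∀ i ≤ n, τ i = x i} := by
    intro n x
    simp_rw [chainLaw_cylinder]
    exact (init.measurable_coe (measurableSet_singleton _)).mul
      (Finset.measurable_prod _ fun i _ => hstep _ _)
  refine Measurable.measure_of_isPiSystem_of_isProbabilityMeasure
    (generateFrom_measurableCylinders (α := fun _ : ℕ => S × A)).symm
    isPiSystem_measurableCylinders ?_
  intro C hC
  obtain ⟨I, B, hB, rfl⟩ := (mem_measurableCylinders _).1 hC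
  have hI : I ⊆ Finset.Iic (I.sup id) := fun i hi =>
    Finset.mem_Iic.2 (Finset.le_sup (f := id) hi)
  set n := I.sup id
  have hset : cylinder (α := fun _ : ℕ => S × A) I B =
      Preorder.frestrictLe (π := fun _ : ℕ => S × A) n ⁻¹'
        (Finset.restrict₂ (π := fun _ : ℕ => S × A) hI ⁻¹' B) := rfl
  rw [hset]
  generalize Finset.restrict₂ (π := fun _ : ℕ => S × A) hI ⁻¹' B = D
  have hD : MeasurableSet D := D.to_countable.measurableSet
  have hsum : ∀ θ : Param S A, chainLaw (init θ) (stepKernel θ)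
      (Preorder.frestrictLe (π := fun _ : ℕ => S × A) n ⁻¹' D) =
      ∑' h : D, chainLaw (init θ) (stepKernel θ)
        (Preorder.frestrictLe (π := fun _ : ℕ => S × A) n ⁻¹' {h.1}) := by
    intro θ
    rw [← Measure.map_apply (by fun_prop) hD]
    have hU := measure_biUnion
      (μ := (chainLaw (init θ) (stepKernel θ)).map
        (Preorder.frestrictLe (π := fun _ : ℕ => S × A) n))
      (f := fun h => {h}) D.to_countable
      (fun a _ b _ hab => by simpa using hab) (fun _ _ => measurableSet_singleton _)
    rw [Set.biUnion_of_singleton] at hU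
    rw [hU]
    refine tsum_congr fun h => ?_
    rw [Measure.map_apply (by fun_prop) (measurableSet_singleton _)]
  simp_rw [hsum]
  refine Measurable.tsum fun h => ?_
  have hx : ∃ x : ℕ → S × A, Preorder.frestrictLe (π := fun _ : ℕ => S × A) n x = h.1 := by
    refine ⟨fun i => if hi : i ∈ Finset.Iic n then h.1 ⟨i, hi⟩ else h.1 ⟨0, by simp⟩, ?_⟩
    funext ⟨i, hi⟩
    simp [Finset.mem_Iic.1 hi]
  obtain ⟨x, hx⟩ := hx
  have hs : Preorder.frestrictLe (π := fun _ : ℕ => S × A) n ⁻¹' {h.1} =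
      {τ | ∀ i ≤ n, τ i = x i} := by
    rw [← hx]
    ext τ
    simp only [Set.mem_ofPred_eq, Set.mem_preimage, Set.mem_singleton_iff, funext_iff]
    constructor
    · intro h i hi
      exact h ⟨i, Finset.mem_Iic.2 hi⟩
    · rintro h ⟨i, hi⟩
      exact h i (Finset.mem_Iic.1 hi)
  rw [hs]
  exact hcyl n x

/-- The kernel sending `θ` to the law of the infinite state-action sequence that it generates
when the first state-action pair has law `init θ`. -/
def chainKernel (init : Kernel (Param S A) (S × A)) [IsMarkovKernel init] :
    Kernel (Param S A) (ℕ → S × A) where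
  toFun θ := chainLaw (init θ) (stepKernel θ)
  measurable' := measurable_chainLaw init

/-- The law of the infinite state-action sequence obtained by rolling out `p`: draw `θ ∼ p`, then
run the chain of `θ` started from `init θ`. -/
def rollout (init : Kernel (Param S A) (S × A)) [IsMarkovKernel init]
    (p : Measure (Param S A)) : Measure (ℕ → S × A) :=
  p.bind (chainKernel init)

/-- The likelihood `∏_{i < t} F(s_{i+1} | s_i, a_i)` of the observed transitions. -/
def transitionLikelihood {t : ℕ} (s : Fin (t + 1) → S) (a : Fin t → A) (θ : Param S A) : ℝ≥0∞ :=
  ∏ i : Fin t, (θ.1 (s i.castSucc, a i) : Measure S) {s i.succ}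

/-- The interventional posterior, proportional to `p(dθ) ∏_{i < t} F(s_{i+1} | s_i, a_i)`; it is a
probability measure whenever the normalizing constant is nonzero, and zero otherwise. -/
def interventionalPosterior (p : Measure (Param S A)) {t : ℕ} (s : Fin (t + 1) → S)
    (a : Fin t → A) : Measure (Param S A) :=
  (∫⁻ θ, transitionLikelihood s a θ ∂p)⁻¹ • p.withDensity (transitionLikelihood s a)

/-- The interventional policy: the action law given the history `s_0, a_0, …, a_{t-1}, s_t`,
obtained by averaging `π(· | s_t)` over the interventional posterior. -/
def interventionalPolicy (p : Measure (Param S A)) {t : ℕ} (s : Fin (t + 1) → S)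
    (a : Fin t → A) : Measure A :=
  (interventionalPosterior p s a).bind fun θ => (θ.2 (s (Fin.last t)) : Measure A)

end MDP

end CountableMDP

end

/-! A single trajectory already reveals its parameter. If the chain of a recurrent `θ` visits `x`
infinitely often, the jumps out of its successive visits to `x` are independent with law `K x`, by
the Markov property at the visit times; the strong law of large numbers then makes their empirical
frequencies converge to the transition probabilities `K x {y}` (`tendsto_jumpFrequency`). Summing
`F(s' | x) π(a' | s')` over `a'` gives `F`, and dividing by `F(s' | x)` gives `π`, since recurrence
makes every state reachable in one step from some pair (`Recurrent.reconstruct_stepKernel`).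

So one measurable map `estimate`, chosen independently of `p` and of the initial law, returns
`evaluation θ` almost surely. It pushes the rollout of `p` to the law of `evaluation` under `p`
(`map_estimate_rollout`), and the evaluations generate the σ-algebra of the parameter space, so `p`
is determined. The corollary follows by choosing any preimage of the rollout law. -/

noncomputable section

namespace CountableMDP

/-! ### Successive visits to a point and the jumps that follow them -/

section Visits

variable {X : Type*}

open Classical in
/-- The trajectories whose `k`-th visit to `x` (counted from `0`) takes place at time `n`. -/
def visitAt (x : X) (k n : ℕ) : Set (ℕ → X) :=
  {τ | τ n = x ∧ Nat.count (fun i => τ i = x) n = k}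

/-- The trajectories which jump to `y` right after their `k`-th visit to `x`. -/
def jumpAfterVisit (x y : X) (k : ℕ) : Set (ℕ → X) :=
  {τ | ∃ n, τ ∈ visitAt x k n ∧ τ (n + 1) = y}

/-- The event `E` depends on the first `n + 1` coordinates only. -/
def DeterminedUpTo (n : ℕ) (E : Set (ℕ → X)) : Prop :=
  ∀ τ τ' : ℕ → X, (∀ i ≤ n, τ i = τ' i) → τ ∈ E → τ' ∈ E

theorem determinedUpTo_visitAt (x : X) (k n : ℕ) : DeterminedUpTo n (visitAt x k n) := by
  classical
  rintro τ τ' h ⟨h1, h2⟩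
  refine ⟨(h n le_rfl).symm.trans h1, ?_⟩
  rw [← h2, Nat.count_eq_card_filter_range, Nat.count_eq_card_filter_range]
  congr 1
  refine Finset.filter_congr fun i hi => ?_
  rw [h i (Finset.mem_range.1 hi).le]

theorem eq_of_mem_visitAt {x : X} {k m n : ℕ} {τ : ℕ → X} (hm : τ ∈ visitAt x k m)
    (hn : τ ∈ visitAt x k n) : m = n := by
  classical
  exact Nat.count_injective (p := fun i => τ i = x) hm.1 hn.1 (hm.2.trans hn.2.symm)

theorem lt_of_mem_visitAt {x : X} {j k m n : ℕ} {τ : ℕ → X} (hjk : j < k)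
    (hm : τ ∈ visitAt x j m) (hn : τ ∈ visitAt x k n) : m < n := by
  classical
  by_contra! h
  have := Nat.count_monotone (fun i => τ i = x) h
  rw [hm.2, hn.2] at this
  omega

theorem exists_mem_visitAt {x : X} {τ : ℕ → X} (h : ∃ᶠ n in atTop, τ n = x) (k : ℕ) :
    ∃ n, τ ∈ visitAt x k n := by
  classical
  rw [Nat.frequently_atTop_iff_infinite] at h
  exact ⟨Nat.nth (fun i => τ i = x) k, Nat.nth_mem_of_infinite h k,
    Nat.count_nth_of_infinite h k⟩

/-- The jump out of the earlier visit lands no later than the `k`-th visit, hence belongs to the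
past of that visit. This is the source of independence. -/
theorem determinedUpTo_jumpAfterVisit_inter_visitAt (x y : X) {j k : ℕ} (hjk : j < k) (n : ℕ) :
    DeterminedUpTo n (jumpAfterVisit x y j ∩ visitAt x k n) := by
  rintro τ τ' h ⟨⟨m, hm, hy⟩, hn⟩
  have hmn := lt_of_mem_visitAt hjk hm hn
  exact ⟨⟨m, determinedUpTo_visitAt x j m τ τ' (fun i hi => h i (hi.trans hmn.le)) hm,
    (h (m + 1) hmn).symm.trans hy⟩, determinedUpTo_visitAt x k n τ τ' h hn⟩

variable [MeasurableSpace X] [Countable X] [DiscreteMeasurableSpace X]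

/-- Histories up to time `n` form a countable discrete space, so every set of them is measurable. -/
theorem DeterminedUpTo.exists_eq_preimage {n : ℕ} {E : Set (ℕ → X)} (hE : DeterminedUpTo n E) :
    ∃ D : Set ((i : Finset.Iic n) → X), MeasurableSet D ∧
      E = Preorder.frestrictLe (π := fun _ : ℕ => X) n ⁻¹' D := by
  refine ⟨Preorder.frestrictLe (π := fun _ : ℕ => X) n '' E,
    (Set.to_countable _).measurableSet, Set.Subset.antisymm (Set.subset_preimage_image _ _) ?_⟩
  rintro τ' ⟨τ, hτ, h⟩
  exact hE τ τ' (fun i hi => congrFun h ⟨i, Finset.mem_Iic.2 hi⟩) hτ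

theorem DeterminedUpTo.measurableSet {n : ℕ} {E : Set (ℕ → X)} (hE : DeterminedUpTo n E) :
    MeasurableSet E := by
  obtain ⟨D, hD, rfl⟩ := hE.exists_eq_preimage
  exact (Preorder.measurable_frestrictLe (X := fun _ : ℕ => X) n) hD

theorem measurableSet_coord_eq (n : ℕ) (y : X) : MeasurableSet {τ : ℕ → X | τ n = y} :=
  measurableSet_eq_fun (measurable_pi_apply n) measurable_const

theorem measurableSet_jumpAfterVisit (x y : X) (k : ℕ) :
    MeasurableSet (jumpAfterVisit x y k) := by
  have : jumpAfterVisit x y k = ⋃ n, visitAt x k n ∩ {τ | τ (n + 1) = y} := by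
    ext τ; simp [jumpAfterVisit]
  rw [this]
  exact MeasurableSet.iUnion fun n =>
    (determinedUpTo_visitAt x k n).measurableSet.inter (measurableSet_coord_eq _ _)

end Visits

/-! ### Markov property at visit times -/

section Markov

variable {X : Type*} [MeasurableSpace X] [Countable X] [DiscreteMeasurableSpace X]
  (μ : Measure X) [IsProbabilityMeasure μ] (K : Kernel X X) [IsMarkovKernel K]

/-- The Markov property. -/
theorem chainLaw_inter_next {n : ℕ} {E : Set (ℕ → X)} (hE : DeterminedUpTo n E) {x : X}
    (hx : ∀ τ ∈ E, τ n = x) (y : X) :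
    chainLaw μ K (E ∩ {τ | τ (n + 1) = y}) = chainLaw μ K E * K x {y} := by
  obtain ⟨D, hD, rfl⟩ := hE.exists_eq_preimage
  have hs : Preorder.frestrictLe (π := fun _ : ℕ => X) n ⁻¹' D ∩ {τ | τ (n + 1) = y} =
      (fun τ : ℕ → X => (Preorder.frestrictLe (π := fun _ => X) n τ, τ (n + 1))) ⁻¹'
        (D ×ˢ {y}) := rfl
  -- The hypothesis `hx` concerns full trajectories, so a finite history is extended by a constant
  -- before applying it.
  have hc : ∀ h ∈ D, h ⟨n, Finset.mem_Iic.2 le_rfl⟩ = x := by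
    intro h hh
    let τ : ℕ → X := fun i =>
      if hi : i ∈ Finset.Iic n then h ⟨i, hi⟩ else h ⟨n, Finset.mem_Iic.2 le_rfl⟩
    have hτ : Preorder.frestrictLe (π := fun _ : ℕ => X) n τ = h := by
      funext ⟨i, hi⟩
      simp [τ, Finset.mem_Iic.1 hi]
    have := hx τ (by rw [Set.mem_preimage, hτ]; exact hh)
    simpa [τ] using this
  rw [hs, ← Measure.map_apply (by fun_prop) hD,
    ← Measure.map_apply (by fun_prop) (hD.prod (measurableSet_singleton _)), chainLaw,
    ← Kernel.map_frestrictLe_trajMeasure_compProd_eq_map_trajMeasure,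
    Measure.compProd_apply_prod hD (measurableSet_singleton _), mul_comm, ← setLIntegral_const]
  refine setLIntegral_congr_fun hD fun h hh => ?_
  rw [Kernel.comap_apply, hc h hh]

theorem chainLaw_next (n : ℕ) (y : X) :
    chainLaw μ K {τ | τ (n + 1) = y} = ∑' x, chainLaw μ K {τ | τ n = x} * K x {y} := by
  have hU : {τ : ℕ → X | τ (n + 1) = y} = ⋃ x, {τ | τ n = x} ∩ {τ | τ (n + 1) = y} := by
    ext τ; simp
  rw [hU, measure_iUnion]
  · refine tsum_congr fun x => chainLaw_inter_next μ K ?_ (fun τ h => h) y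
    intro τ τ' h hτ
    exact (h n le_rfl).symm.trans hτ
  · intro a b hab
    refine Set.disjoint_left.2 ?_
    rintro τ ⟨h1, -⟩ ⟨h2, -⟩
    exact hab (h1.symm.trans h2)
  · exact fun x => (measurableSet_coord_eq _ _).inter (measurableSet_coord_eq _ _)

/-- Strong Markov property: split according to the time of the `k`-th visit, almost surely finite,
and apply the Markov property at each time. `Q` is any event in the past of that visit: the whole
space yields the law of the jump, an earlier jump yields independence. -/
theorem chainLaw_inter_jumpAfterVisit {x : X} (hx : ∀ᵐ τ ∂(chainLaw μ K), ∃ᶠ n in atTop, τ n = x)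
    (y : X) (k : ℕ) {Q : Set (ℕ → X)} (hQ : ∀ n, DeterminedUpTo n (Q ∩ visitAt x k n)) :
    chainLaw μ K (Q ∩ jumpAfterVisit x y k) = chainLaw μ K Q * K x {y} := by
  have hd : Pairwise (Function.onFun Disjoint fun n => Q ∩ visitAt x k n) := by
    intro a b hab
    refine Set.disjoint_left.2 ?_
    rintro τ ⟨-, h1⟩ ⟨-, h2⟩
    exact hab (eq_of_mem_visitAt h1 h2)
  have h1 : Q ∩ jumpAfterVisit x y k =
      ⋃ n, (Q ∩ visitAt x k n) ∩ {τ | τ (n + 1) = y} := by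
    ext τ; simp [jumpAfterVisit]; tauto
  have h2 : chainLaw μ K Q = chainLaw μ K (⋃ n, Q ∩ visitAt x k n) := by
    rw [← Set.inter_iUnion]
    refine (measure_inter_conull' ?_).symm
    refine measure_mono_null ?_ (ae_iff.1 hx)
    rintro τ ⟨-, hτ⟩ h
    exact hτ (Set.mem_iUnion.2 (exists_mem_visitAt h k))
  rw [h2, h1, measure_iUnion hd fun n => (hQ n).measurableSet, measure_iUnion,
    ← ENNReal.tsum_mul_right]
  · exact tsum_congr fun n => chainLaw_inter_next μ K (hQ n) (fun τ h => h.2.1) y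
  · exact fun a b hab => (hd hab).mono Set.inter_subset_left Set.inter_subset_left
  · exact fun n => (hQ n).measurableSet.inter (measurableSet_coord_eq _ _)

theorem chainLaw_jumpAfterVisit {x : X} (hx : ∀ᵐ τ ∂(chainLaw μ K), ∃ᶠ n in atTop, τ n = x)
    (y : X) (k : ℕ) : chainLaw μ K (jumpAfterVisit x y k) = K x {y} := by
  have := chainLaw_inter_jumpAfterVisit μ K hx y k (Q := Set.univ)
    (fun n => by simpa using determinedUpTo_visitAt x k n)
  simpa using this

theorem indepSet_jumpAfterVisit {x : X} (hx : ∀ᵐ τ ∂(chainLaw μ K), ∃ᶠ n in atTop, τ n = x)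
    (y : X) {j k : ℕ} (hjk : j < k) :
    IndepSet (jumpAfterVisit x y j) (jumpAfterVisit x y k) (chainLaw μ K) := by
  rw [indepSet_iff_measure_inter_eq_mul (measurableSet_jumpAfterVisit x y j)
    (measurableSet_jumpAfterVisit x y k) (chainLaw μ K), chainLaw_inter_jumpAfterVisit μ K hx y k
    (determinedUpTo_jumpAfterVisit_inter_visitAt x y hjk), chainLaw_jumpAfterVisit μ K hx y k]

/-! ### Strong law for the empirical transition frequencies -/

theorem _root_.ProbabilityTheory.IndepSet.indepFun_indicator_one {Ω : Type*} [MeasurableSpace Ω]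
    {P : Measure Ω} {s t : Set Ω} (h : IndepSet s t P) :
    IndepFun (s.indicator fun _ => (1 : ℝ)) (t.indicator fun _ => (1 : ℝ)) P := by
  rw [IndepSet_iff_Indep] at h
  rw [IndepFun_iff_Indep]
  have key : ∀ u : Set Ω, MeasurableSpace.comap (u.indicator fun _ => (1 : ℝ)) inferInstance ≤
      MeasurableSpace.generateFrom {u} := by
    intro u
    rw [← measurable_iff_comap_le]
    exact measurable_const.indicator (MeasurableSpace.measurableSet_generateFrom rfl)
  exact indep_of_indep_of_le_left (indep_of_indep_of_le_right h (key t)) (key s)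

/-- The proportion of jumps to `y` among the jumps that follow the first `n` visits to `x`. -/
def jumpFrequency (x y : X) (n : ℕ) (τ : ℕ → X) : ℝ :=
  (∑ k ∈ Finset.range n, (jumpAfterVisit x y k).indicator (fun _ => (1 : ℝ)) τ) / n

theorem measurable_jumpFrequency (x y : X) (n : ℕ) : Measurable (jumpFrequency x y n) :=
  (Finset.measurable_fun_sum _ fun k _ =>
    measurable_const.indicator (measurableSet_jumpAfterVisit x y k)).div_const _

theorem tendsto_jumpFrequency {x : X} (hx : ∀ᵐ τ ∂(chainLaw μ K), ∃ᶠ n in atTop, τ n = x)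
    (y : X) :
    ∀ᵐ τ ∂(chainLaw μ K),
      Tendsto (fun n => jumpFrequency x y n τ) atTop (nhds ((K x {y}).toReal)) := by
  have hm := fun k => measurableSet_jumpAfterVisit x y k
  have hmf : ∀ k, Measurable ((jumpAfterVisit x y k).indicator fun _ => (1 : ℝ)) :=
    fun k => measurable_const.indicator (hm k)
  have hint : ∀ k, Integrable ((jumpAfterVisit x y k).indicator fun _ => (1 : ℝ)) (chainLaw μ K) :=
    fun k => (integrable_const _).indicator (hm k)
  -- This form of the strong law asks only for pairwise independence and identical distribution.
  have h := strong_law_ae_real (μ := chainLaw μ K)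
    (fun k => (jumpAfterVisit x y k).indicator fun _ => (1 : ℝ)) (hint 0) ?_ ?_
  · have he : ∫ τ, (jumpAfterVisit x y 0).indicator (fun _ => (1 : ℝ)) τ ∂(chainLaw μ K) =
        (K x {y}).toReal := by
      rw [integral_indicator_const _ (hm 0), Measure.real, chainLaw_jumpAfterVisit μ K hx]
      simp
    rw [he] at h
    exact h
  · intro j k hjk
    rcases lt_or_gt_of_ne hjk with h | h
    · exact (indepSet_jumpAfterVisit μ K hx y h).indepFun_indicator_one
    · exact (indepSet_jumpAfterVisit μ K hx y h).indepFun_indicator_one.symm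
  · intro k
    refine ⟨(hmf k).aemeasurable, (hmf 0).aemeasurable, ?_⟩
    ext B hB
    rw [Measure.map_apply (hmf k) hB, Measure.map_apply (hmf 0) hB]
    have hcompl : ∀ k, chainLaw μ K (jumpAfterVisit x y k)ᶜ = 1 - K x {y} := fun k => by
      rw [prob_compl_eq_one_sub (hm k), chainLaw_jumpAfterVisit μ K hx]
    classical
    simp only [Set.indicator_const_preimage_eq_union]
    split_ifs <;> simp [hcompl, chainLaw_jumpAfterVisit μ K hx]

/-- `Recurrent` speaks of deterministic starting points; this mixture formula carries it to an
arbitrary initial law. -/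
theorem chainLaw_apply_eq_lintegral_dirac {B : Set (ℕ → X)} (hB : MeasurableSet B) :
    chainLaw μ K B = ∫⁻ x, chainLaw (Measure.dirac x) K B ∂μ := by
  unfold chainLaw Kernel.trajMeasure
  rw [Measure.bind_apply hB (Kernel.aemeasurable _),
    lintegral_map (Kernel.measurable_coe _ hB) (MeasurableEquiv.measurable _)]
  refine lintegral_congr fun x => Eq.symm ?_
  rw [Measure.bind_apply hB (Kernel.aemeasurable _),
    lintegral_map (Kernel.measurable_coe _ hB) (MeasurableEquiv.measurable _)]
  exact lintegral_dirac' _ ((Kernel.measurable_coe _ hB).comp (MeasurableEquiv.measurable _))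

theorem measurableSet_frequently_eq (y : X) :
    MeasurableSet {τ : ℕ → X | ∃ᶠ n in atTop, τ n = y} := by
  simp only [frequently_atTop, Set.ofPred_forall, Set.ofPred_exists]
  refine MeasurableSet.iInter fun a => MeasurableSet.iUnion fun b => ?_
  exact (MeasurableSet.const _).inter (measurableSet_coord_eq b y)

theorem chainLaw_frequently_of_dirac {y : X}
    (h : ∀ x, ∀ᵐ τ ∂(chainLaw (Measure.dirac x) K), ∃ᶠ n in atTop, τ n = y) :
    ∀ᵐ τ ∂(chainLaw μ K), ∃ᶠ n in atTop, τ n = y := by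
  rw [ae_iff, ← Set.compl_ofPred, chainLaw_apply_eq_lintegral_dirac μ K
    (measurableSet_frequently_eq y).compl]
  simp_rw [Set.compl_ofPred, fun x => ae_iff.1 (h x), lintegral_zero]

/-- An estimate of the transition probability from `x` to `y`. -/
def estimatedTransition (x y : X) (τ : ℕ → X) : ℝ≥0∞ :=
  limsup (fun n => ENNReal.ofReal (jumpFrequency x y n τ)) atTop

/-- A limit superior is defined on every trajectory, so no exceptional set depending on the chain
has to be removed. -/
theorem measurable_estimatedTransition (x y : X) : Measurable (estimatedTransition x y) :=
  Measurable.limsup fun n => (measurable_jumpFrequency x y n).ennreal_ofReal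

theorem estimatedTransition_ae_eq {x : X}
    (hx : ∀ᵐ τ ∂(chainLaw μ K), ∃ᶠ n in atTop, τ n = x) (y : X) :
    ∀ᵐ τ ∂(chainLaw μ K), estimatedTransition x y τ = K x {y} := by
  filter_upwards [tendsto_jumpFrequency μ K hx y] with τ hτ
  have := (ENNReal.tendsto_ofReal hτ).limsup_eq
  rwa [ENNReal.ofReal_toReal (measure_ne_top _ _)] at this

end Markov

/-! ### Recovering the parameter and its law -/

section Identification

variable {S A : Type*} [MeasurableSpace S] [MeasurableSpace A]

/-- The family of all transition probabilities and action probabilities of a parameter. -/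
def evaluation (θ : Param S A) : ((S × A) × S) ⊕ (S × A) → ℝ≥0∞ :=
  Sum.elim (fun q => (θ.1 q.1 : Measure S) {q.2}) (fun q => (θ.2 q.1 : Measure A) {q.2})

/-- Reconstruction of the dynamics and the policy from the transition matrix of the chain. -/
def reconstruct (k : S × A → S × A → ℝ≥0∞) : ((S × A) × S) ⊕ (S × A) → ℝ≥0∞ :=
  Sum.elim (fun q => ∑' a, k q.1 (q.2, a)) (fun q => ⨆ x, k x q / ∑' a, k x (q.1, a))

theorem measurable_reconstruct [Countable S] [Countable A] :
    Measurable (reconstruct : (S × A → S × A → ℝ≥0∞) → _) := by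
  have hk : ∀ x y : S × A, Measurable fun k : S × A → S × A → ℝ≥0∞ => k x y := fun x y =>
    (measurable_pi_apply y).comp (measurable_pi_apply x)
  refine measurable_pi_iff.2 ?_
  rintro (q | q)
  · exact Measurable.tsum fun a => hk _ _
  · exact Measurable.iSup fun x => (hk _ _).div (Measurable.tsum fun a => hk _ _)

variable [Countable S] [Countable A] [DiscreteMeasurableSpace S] [DiscreteMeasurableSpace A]

theorem measurable_probabilityMeasure_of_singleton {Ω Y : Type*} [MeasurableSpace Ω]
    [MeasurableSpace Y] [Countable Y] [DiscreteMeasurableSpace Y] {f : Ω → ProbabilityMeasure Y}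
    (h : ∀ y, Measurable fun ω => (f ω : Measure Y) {y}) : Measurable f := by
  refine Measurable.subtype_mk (f := fun ω => (f ω : Measure Y))
    (Measure.measurable_of_measurable_coe _ fun B hB => ?_)
  have : ∀ ω, (f ω : Measure Y) B = ∑' y, B.indicator (fun y => (f ω : Measure Y) {y}) y :=
    fun ω => (Measure.tsum_indicator_apply_singleton _ _ hB).symm
  simp_rw [this]
  refine Measurable.tsum fun y => ?_
  by_cases hy : y ∈ B
  · simpa [hy] using h y
  · simp [hy]

theorem measurable_evaluation : Measurable (evaluation : Param S A → _) := by
  refine measurable_pi_iff.2 ?_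
  rintro (q | q)
  · exact (Measure.measurable_coe (measurableSet_singleton q.2)).comp
      (measurable_subtype_coe.comp ((measurable_pi_apply q.1).comp measurable_fst))
  · exact (Measure.measurable_coe (measurableSet_singleton q.2)).comp
      (measurable_subtype_coe.comp ((measurable_pi_apply q.1).comp measurable_snd))

/-- The identity is measurable from the σ-algebra generated by `evaluation`, because a probability
measure on a countable space depends measurably on its point masses. -/
theorem exists_eq_evaluation_preimage {E : Set (Param S A)} (hE : MeasurableSet E) :
    ∃ D, MeasurableSet D ∧ evaluation ⁻¹' D = E := by
  have h : @Measurable _ _ (MeasurableSpace.comap (evaluation (S := S) (A := A)) inferInstance)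
      inferInstance (fun θ : Param S A => θ) := by
    let m := MeasurableSpace.comap (evaluation (S := S) (A := A)) inferInstance
    have he : Measurable[m] (evaluation (S := S) (A := A)) := comap_measurable _
    have h1 : Measurable[m] fun θ : Param S A => θ.1 :=
      @measurable_pi_lambda _ _ _ m _ _ fun x =>
        @measurable_probabilityMeasure_of_singleton _ _ m _ _ _ _ fun s' =>
          (measurable_pi_apply (Sum.inl (x, s'))).comp he
    have h2 : Measurable[m] fun θ : Param S A => θ.2 :=
      @measurable_pi_lambda _ _ _ m _ _ fun s =>
        @measurable_probabilityMeasure_of_singleton _ _ m _ _ _ _ fun a =>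
          (measurable_pi_apply (Sum.inr (s, a))).comp he
    exact Measurable.prodMk h1 h2
  exact h hE

theorem eq_of_map_evaluation_eq {p p' : Measure (Param S A)}
    (h : p.map evaluation = p'.map evaluation) : p = p' := by
  ext E hE
  obtain ⟨D, hD, rfl⟩ := exists_eq_evaluation_preimage hE
  rw [← Measure.map_apply measurable_evaluation hD, h, Measure.map_apply measurable_evaluation hD]

/-- Otherwise `y` could never be entered after time `0`, and the chain started at `y` would not
return. -/
theorem Recurrent.exists_dynamics_ne_zero {θ : Param S A} (hθ : Recurrent θ) (y : S × A) :
    ∃ x, (θ.1 x : Measure S) {y.1} ≠ 0 := by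
  by_contra! h
  have hK : ∀ x, stepKernel θ x {y} = 0 := fun x => by
    rw [← Prod.mk.eta (p := y), stepKernel_singleton, h x, zero_mul]
  have h0 : ∀ᵐ τ ∂(chainLaw (Measure.dirac y) (stepKernel θ)), ∀ n, τ (n + 1) ≠ y := by
    refine ae_all_iff.2 fun n => ?_
    rw [ae_iff]
    simp only [ne_eq, not_not]
    rw [chainLaw_next]
    simp [hK]
  obtain ⟨τ, h1, h2⟩ := (h0.and (hθ y y)).exists
  obtain ⟨n, hn, hy⟩ := frequently_atTop.1 h2 1
  obtain ⟨m, rfl⟩ := Nat.exists_eq_add_of_le' hn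
  exact h1 m hy

theorem tsum_stepKernel (θ : Param S A) (x : S × A) (s : S) :
    ∑' a, stepKernel θ x {(s, a)} = (θ.1 x : Measure S) {s} := by
  simp_rw [stepKernel_singleton, ENNReal.tsum_mul_left]
  have : ∑' a, (θ.2 s : Measure A) {a} = 1 := by
    have := Measure.tsum_indicator_apply_singleton (θ.2 s : Measure A) _ MeasurableSet.univ
    simpa using this
  rw [this, mul_one]

/-- Each ratio in the supremum equals `π(a | s)` when `F(s | x) ≠ 0`, and `0 / 0 = 0` otherwise; one
good `x` therefore suffices. -/
theorem Recurrent.reconstruct_stepKernel {θ : Param S A} (hθ : Recurrent θ) :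
    reconstruct (fun x y => stepKernel θ x {y}) = evaluation θ := by
  funext q
  rcases q with q | ⟨s, a⟩
  · exact tsum_stepKernel θ q.1 q.2
  · change ⨆ x, stepKernel θ x {(s, a)} / ∑' a, stepKernel θ x {(s, a)} = (θ.2 s : Measure A) {a}
    simp_rw [tsum_stepKernel, stepKernel_singleton]
    refine le_antisymm (iSup_le fun x => ?_) ?_
    · rw [mul_comm]
      exact ENNReal.div_le_of_le_mul le_rfl
    · obtain ⟨x, hx⟩ := hθ.exists_dynamics_ne_zero (s, a)
      refine le_iSup_of_le x ?_
      rw [mul_comm, ENNReal.mul_div_cancel_right hx (measure_ne_top _ _)]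

/-- The estimate of the parameters of the chain from one trajectory. -/
def estimate (τ : ℕ → S × A) : ((S × A) × S) ⊕ (S × A) → ℝ≥0∞ :=
  reconstruct fun x y => estimatedTransition x y τ

theorem measurable_estimate : Measurable (estimate : (ℕ → S × A) → _) :=
  measurable_reconstruct.comp (measurable_pi_iff.2 fun x => measurable_pi_iff.2 fun y =>
    measurable_estimatedTransition x y)

theorem Recurrent.estimate_ae_eq {θ : Param S A} (hθ : Recurrent θ) (μ : Measure (S × A))
    [IsProbabilityMeasure μ] :
    ∀ᵐ τ ∂(chainLaw μ (stepKernel θ)), estimate τ = evaluation θ := by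
  have h : ∀ᵐ τ ∂(chainLaw μ (stepKernel θ)), ∀ x y,
      estimatedTransition x y τ = stepKernel θ x {y} :=
    ae_all_iff.2 fun x => ae_all_iff.2 fun y => estimatedTransition_ae_eq μ (stepKernel θ)
      (chainLaw_frequently_of_dirac μ (stepKernel θ) fun z => hθ z x) y
  filter_upwards [h] with τ hτ
  rw [estimate, ← hθ.reconstruct_stepKernel]
  simp_rw [hτ]

/-- Given `θ`, the estimate is almost surely the constant `evaluation θ`, so `init` disappears from
the result. -/
theorem map_estimate_rollout (init : Kernel (Param S A) (S × A)) [IsMarkovKernel init]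
    (p : Measure (Param S A)) (hp : ∀ᵐ θ ∂p, Recurrent θ) :
    (rollout init p).map estimate = p.map evaluation := by
  ext D hD
  rw [Measure.map_apply measurable_estimate hD, rollout,
    Measure.bind_apply (measurable_estimate hD) (Kernel.aemeasurable _),
    Measure.map_apply measurable_evaluation hD,
    ← lintegral_indicator_one (measurable_evaluation hD)]
  refine lintegral_congr_ae ?_
  filter_upwards [hp] with θ hθ
  change chainLaw (init θ) (stepKernel θ) (estimate ⁻¹' D) = _
  have h := hθ.estimate_ae_eq (init θ)
  by_cases hD' : evaluation θ ∈ D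
  · rw [Set.indicator_of_mem (s := evaluation ⁻¹' D) hD', Pi.one_apply]
    refine (mem_ae_iff_prob_eq_one (measurable_estimate hD)).1 ?_
    filter_upwards [h] with τ hτ
    rwa [Set.mem_preimage, hτ]
  · rw [Set.indicator_of_notMem (s := evaluation ⁻¹' D) hD']
    refine measure_eq_zero_iff_ae_notMem.2 ?_
    filter_upwards [h] with τ hτ
    rwa [Set.mem_preimage, hτ]

theorem eq_of_rollout_eq (init init' : Kernel (Param S A) (S × A)) [IsMarkovKernel init]
    [IsMarkovKernel init'] {p p' : Measure (Param S A)} (hp : ∀ᵐ θ ∂p, Recurrent θ)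
    (hp' : ∀ᵐ θ ∂p', Recurrent θ) (h : rollout init p = rollout init' p') : p = p' :=
  eq_of_map_evaluation_eq <| by
    rw [← map_estimate_rollout init p hp, h, map_estimate_rollout init' p' hp']

end Identification

end CountableMDP
end

open CountableMDP in
theorem mainTheorem1 {S A : Type*} [MeasurableSpace S] [MeasurableSpace A]
    [Countable S] [Countable A] [DiscreteMeasurableSpace S] [DiscreteMeasurableSpace A] :
    (∀ (init init' : Kernel (Param S A) (S × A)) [IsMarkovKernel init] [IsMarkovKernel init']
        (p p' : Measure (Param S A)) [IsProbabilityMeasure p] [IsProbabilityMeasure p'],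
        (∀ᵐ θ ∂p, Recurrent θ) → (∀ᵐ θ ∂p', Recurrent θ) →
        rollout init p = rollout init' p' → p = p') ∧
    (∃ G : Measure (ℕ → S × A) →
        ((t : ℕ) → (Fin (t + 1) → S) → (Fin t → A) → Measure A),
      ∀ (init : Kernel (Param S A) (S × A)) [IsMarkovKernel init]
        (p : Measure (Param S A)) [IsProbabilityMeasure p],
        (∀ᵐ θ ∂p, Recurrent θ) →
        ∀ (t : ℕ) (s : Fin (t + 1) → S) (a : Fin t → A),
          G (rollout init p) t s a = interventionalPolicy p s a) := by
  refine ⟨fun init init' _ _ p p' _ _ hp hp' h => eq_of_rollout_eq init init' hp hp' h,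
    ?_⟩
  classical
  -- `G` evaluates the interventional policy at some recurrent measure that rolls out to `ρ` under
  -- some initial kernel. By identifiability this is the original `p`; if `ρ` is not such a rollout,
  -- the value is arbitrary.
  let Q : Measure (ℕ → S × A) → Measure (Param S A) → Prop := fun ρ p =>
    (∀ᵐ θ ∂p, Recurrent θ) ∧
      ∃ (init : Kernel (Param S A) (S × A)) (_ : IsMarkovKernel init), rollout init p = ρ
  refine ⟨fun ρ t s a => interventionalPolicy (Classical.epsilon (Q ρ)) s a, ?_⟩
  intro init _ p _ hp t s a
  obtain ⟨hq, init', _, h⟩ : Q (rollout init p) (Classical.epsilon (Q (rollout init p))) :=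
    Classical.epsilon_spec ⟨p, hp, init, inferInstance, rfl⟩
  have := eq_of_rollout_eq init' init hq hp h
  simp only [this]
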